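/- Let $\mathbb K$ be a field of characteristic $0$; all vector spaces and algebras are over $\mathbb K$, and algebras are not required to have a unit. An involution on a vector space $V$ is a linear map $v\mapsto v^*$ with $v^{**}=v$. A nonunitary involutive Rota-Baxter algebra is an associative algebra $A$ with an involution satisfying $(ab)^*=b^*a^*$ and a linear map $R:A\to A$ satisfying $R(a^*)=R(a)^*$ and $R(a)R(b)=R(aR(b)+R(a)b)$; morphisms are the algebra maps that commute with the involutions and the operators $R$. Let $B$ be an algebra with basis $X$. Rota-Baxter words on $X$ are the nonempty finite words $\mathbf x=\mathbf x_1\cdots\mathbf x_k$ whose components $\mathbf x_i$ are alternately letters of $X$ and brackets $\lfloor \mathbf u\rfloor$ of Rota-Baxter words $\mathbf u$. Let $\varpi^{\mathrm{NC},0}(B)$ be the vector space with basis the Rota-Baxter words on $X$, with the bilinear product $$\mathbf x_1\cdots\mathbf x_k\diamond \mathbf y_1\cdots\mathbf y_l=\mathbf x_1\cdots\mathbf x_{k-1}(\mathbf x_k\diamond \mathbf y_1)\mathbf y_2\cdots \mathbf y_l,$$ where $\mathbf x_k\diamond\mathbf y_1$ is the product in $B$ (expanded in the basis $X$) if both are letters,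 the concatenation if exactly one of them is a letter, and, recursively, $\lfloor \mathbf u\rfloor\diamond\lfloor \mathbf v\rfloor=\lfloor\lfloor \mathbf u\rfloor\diamond \mathbf v\rfloor+\lfloor \mathbf u\diamond\lfloor \mathbf v\rfloor\rfloor$. Let $R_B$ be the linear map with $R_B(\mathbf x)=\lfloor \mathbf x\rfloor$, and $j_B:B\to\varpi^{\mathrm{NC},0}(B)$ the linear map that sends each $x\in X$ to the one-letter word $x$. If $B$ carries an involution with $(ab)^*=b^*a^*$, define a linear map $*$ on $\varpi^{\mathrm{NC},0}(B)$ by $x^*=j_B(x^*)$ for $x\in X$, $\lfloor \mathbf u\rfloor^*=\lfloor \mathbf u^*\rfloor$ and $(\mathbf x_1\cdots\mathbf x_k)^*=\mathbf x_k^*\cdots\mathbf x_1^*$ (extended multilinearly). Let $V$ be a vector space with an involution, let $T(V)=\bigoplus_{n\ge1}V^{\otimes n}$ with the involution $(v_1\otimes\cdots\otimes v_n)^*=v_n^*\otimes\cdots\otimes v_1^*$, let $i:V\to T(V)$ be the inclusion, and let $X$ be any basis of $T(V)$. Then $\varpi^{\mathrm{NC},0}(T(V))$, with $\diamond$, $*$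 and $R_{T(V)}$, is a nonunitary involutive Rota-Baxter algebra, the map $j_{T(V)}\circ i$ preserves the involutions, and for every nonunitary involutive Rota-Baxter algebra $A$ and every linear map $f:V\to A$ preserving the involutions there is a unique morphism of nonunitary involutive Rota-Baxter algebras $\widetilde f:\varpi^{\mathrm{NC},0}(T(V))\to A$ with $\widetilde f\circ(j_{T(V)}\circ i)=f$. -/

import Mathlib

universe u v w

noncomputable section

namespace RotaBaxter

/-! ### Involutive Rota-Baxter algebras (of weight zero, nonunitary) -/

section Algebras

variable {K : Type*} [Field K]

/-- `star` and `R` make the (not necessarily unital) `K`-algebra `A` an involutive Rota-Baxter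
algebra. The associativity of `A` is one of the conditions, so that the predicate can be asserted
about a product which is not yet known to be associative. -/
structure IsInvolutiveRotaBaxter {A : Type*} [NonUnitalNonAssocRing A] [Module K A]
    [IsScalarTower K A A] [SMulCommClass K A A] (star R : A →ₗ[K] A) : Prop where
  mul_assoc : ∀ a b c : A, a * b * c = a * (b * c)
  star_star : ∀ a : A, star (star a) = a
  star_mul : ∀ a b : A, star (a * b) = star b * star a
  rota_baxter : ∀ a b : A, R a * R b = R (a * R b + R a * b)
  map_star : ∀ a : A, R (star a) = star (R a)

/-- Morphisms of involutive Rota-Baxter algebras: algebra maps (not required to respect any unit)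
that commute with the involutions and with the Rota-Baxter operators. -/
structure IsInvolutiveRotaBaxterHom {A A' : Type*}
    [NonUnitalNonAssocRing A] [Module K A] [NonUnitalNonAssocRing A'] [Module K A']
    (star R : A →ₗ[K] A) (star' R' : A' →ₗ[K] A') (φ : A →ₙₐ[K] A') : Prop where
  map_star : ∀ a : A, φ (star a) = star' (φ a)
  map_operator : ∀ a : A, φ (R a) = R' (φ a)

end Algebras

/-! ### Rota-Baxter words -/

/-- Rota-Baxter words on the alphabet `X`, graded by their head: `false` if the word begins with a
letter of `X`, and `true` if it begins with a bracket `⌊u⌋`. A word is a nonempty sequence in which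
letters and brackets `⌊u⌋` of Rota-Baxter words `u` alternate, so that prefixing a letter
requires a word which begins with a bracket and conversely. -/
inductive RBWord (X : Type u) : Bool → Type u
  /-- the word `x` -/
  | letter (x : X) : RBWord X false
  /-- the word `⌊u⌋` -/
  | bracket {h : Bool} (u : RBWord X h) : RBWord X true
  /-- the concatenation `x w`, where `w` begins with a bracket -/
  | letterCons (x : X) (w : RBWord X true) : RBWord X false
  /-- the concatenation `⌊u⌋ w`, where `w` begins with a letter -/
  | bracketCons {h : Bool} (u : RBWord X h) (w : RBWord X false) : RBWord X true

/-! ### The algebra of Rota-Baxter words on a basis of an algebra -/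

section WordAlgebra

variable {K : Type v} [Field K] {B : Type w} [NonUnitalRing B] [Module K B] {X : Type u}

/-- The product of two Rota-Baxter words on a basis `b` of the algebra `B`. All but the last
component of the left factor are kept in front; the last component `x` or `⌊u⌋` of the left factor is
multiplied with the first component of the right factor, and the rest of the right factor is kept.
Two letters are multiplied in `B`, a letter and a bracket are concatenated, and
`⌊u⌋ ⌊v⌋ = ⌊⌊u⌋ v⌋ + ⌊u ⌊v⌋⌋`. All words occurring in the product have the same head as the left
factor. -/
def mulWord (b : Module.Basis X K B) :
    {h h' : Bool} → RBWord X h → RBWord X h' → (RBWord X h →₀ K)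
  | _, _, .letterCons x w, y => (mulWord b w y).mapDomain (.letterCons x)
  | _, _, .bracketCons u w, y => (mulWord b w y).mapDomain (.bracketCons u)
  | _, _, .letter x, .letter y => (b.repr (b x * b y)).mapDomain .letter
  | _, _, .letter x, .letterCons y w' => (b.repr (b x * b y)).mapDomain fun z => .letterCons z w'
  | _, _, .letter x, .bracket v => .single (.letterCons x (.bracket v)) 1
  | _, _, .letter x, .bracketCons v w' => .single (.letterCons x (.bracketCons v w')) 1
  | _, _, .bracket u, .letter y => .single (.bracketCons u (.letter y)) 1
  | _, _, .bracket u, .letterCons y w' => .single (.bracketCons u (.letterCons y w')) 1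
  | _, _, .bracket u, .bracket v =>
      (mulWord b (.bracket u) v).mapDomain .bracket +
        (mulWord b u (.bracket v)).mapDomain .bracket
  | _, _, .bracket u, .bracketCons v w' =>
      (mulWord b (.bracket u) v).mapDomain (fun z => .bracketCons z w') +
        (mulWord b u (.bracket v)).mapDomain (fun z => .bracketCons z w')
  termination_by _ _ x y => sizeOf x + sizeOf y

/-- The vector space `ϖ^{NC,0}(B)` with basis the Rota-Baxter words on the basis `b` of `B`. -/
@[nolint unusedArguments]
def RBWordAlgebra (_b : Module.Basis X K B) : Type (max u v) := (Σ h : Bool, RBWord X h) →₀ K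

namespace RBWordAlgebra

variable (b : Module.Basis X K B)

instance : AddCommGroup (RBWordAlgebra b) :=
  inferInstanceAs (AddCommGroup ((Σ h : Bool, RBWord X h) →₀ K))

instance : Module K (RBWordAlgebra b) :=
  inferInstanceAs (Module K ((Σ h : Bool, RBWord X h) →₀ K))

/-- The Rota-Baxter words, as a basis. -/
def wordBasis : Module.Basis (Σ h : Bool, RBWord X h) K (RBWordAlgebra b) :=
  Finsupp.basisSingleOne

/-- The bilinear extension of the product of Rota-Baxter words. -/
def mulLin : RBWordAlgebra b →ₗ[K] RBWordAlgebra b →ₗ[K] RBWordAlgebra b :=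
  (wordBasis b).constr K fun x => (wordBasis b).constr K fun y =>
    Finsupp.linearCombination K (fun z => wordBasis b ⟨x.1, z⟩) (mulWord b x.2 y.2)

instance : Mul (RBWordAlgebra b) := ⟨fun x y => mulLin b x y⟩

variable {b} in
theorem mul_def (x y : RBWordAlgebra b) : x * y = mulLin b x y := rfl

instance : NonUnitalNonAssocRing (RBWordAlgebra b) where
  left_distrib x y z := by simp [mul_def]
  right_distrib x y z := by simp [mul_def]
  zero_mul x := by simp [mul_def]
  mul_zero x := by simp [mul_def]

instance : IsScalarTower K (RBWordAlgebra b) (RBWordAlgebra b) :=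
  ⟨fun c x y => by simp [mul_def, smul_eq_mul]⟩

instance : SMulCommClass K (RBWordAlgebra b) (RBWordAlgebra b) :=
  ⟨fun c x y => by simp [mul_def, smul_eq_mul]⟩

/-- The operator `R_B`, sending a word `x` to `⌊x⌋`. -/
def operator : RBWordAlgebra b →ₗ[K] RBWordAlgebra b :=
  (wordBasis b).constr K fun x => wordBasis b ⟨true, .bracket x.2⟩

/-- The map `j_B : B → ϖ^{NC,0}(B)`, the linear extension of the inclusion of the letters. -/
def incl : B →ₗ[K] RBWordAlgebra b :=
  b.constr K fun x => wordBasis b ⟨false, .letter x⟩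

/-- The involution on words induced by a linear map `σ` on `B`: letters are sent to their image
in `B`, `⌊u⌋* = ⌊u*⌋`, and `(x₁ ⋯ xₙ)* = xₙ* ⋯ x₁*`. The factors on the right are combinations of
letters and of brackets in alternation, so their product is the multilinear concatenation. -/
def starWord (σ : B →ₗ[K] B) : {h : Bool} → RBWord X h → RBWordAlgebra b
  | _, .letter x => incl b (σ (b x))
  | _, .bracket u => operator b (starWord σ u)
  | _, .letterCons x w => starWord σ w * incl b (σ (b x))
  | _, .bracketCons u w => starWord σ w * operator b (starWord σ u)

/-- The involution on `ϖ^{NC,0}(B)` induced by the involution `σ` on `B`. -/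
def star (σ : B →ₗ[K] B) : RBWordAlgebra b →ₗ[K] RBWordAlgebra b :=
  (wordBasis b).constr K fun x => starWord b σ x.2

end RBWordAlgebra

end WordAlgebra

/-! ### The nonunitary tensor algebra -/

section Tensor

variable (K : Type u) [Field K] (V : Type v) [AddCommGroup V] [Module K V]

/-- The nonunitary tensor algebra `⊕_{n ≥ 1} V^{⊗ n}`, as the sum of the components of degree
`n ≥ 1` in the tensor algebra `⊕_{n ≥ 0} V^{⊗ n}`. -/
def tensorPos : NonUnitalSubalgebra K (TensorAlgebra K V) :=
  (⨆ n : ℕ, LinearMap.range (TensorAlgebra.ι K (M := V)) ^ (n + 1)).toNonUnitalSubalgebra (by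
    intro x y hx hy
    refine SetLike.le_def.1 ?_ (Submodule.mul_mem_mul hx hy)
    rw [Submodule.iSup_mul]
    refine iSup_le fun m => ?_
    rw [Submodule.mul_iSup]
    refine iSup_le fun n => ?_
    rw [← pow_add]
    exact le_iSup_of_le (m + 1 + n) (le_of_eq (by congr 1)))

variable {K V}

theorem mem_tensorPos {x : TensorAlgebra K V} : x ∈ tensorPos K V ↔
    x ∈ ⨆ n : ℕ, LinearMap.range (TensorAlgebra.ι K (M := V)) ^ (n + 1) := Iff.rfl

theorem ι_mem_tensorPos (v : V) : TensorAlgebra.ι K v ∈ tensorPos K V :=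
  mem_tensorPos.2 (Submodule.mem_iSup_of_mem 0 (by simp))

variable (K) in
/-- The inclusion `i : V → T(V)`. -/
def tensorIncl : V →ₗ[K] tensorPos K V :=
  (TensorAlgebra.ι K).codRestrict (tensorPos K V).toSubmodule ι_mem_tensorPos

/-- The linear map of the tensor algebra with `v₁ ⊗ ⋯ ⊗ vₙ ↦ σ vₙ ⊗ ⋯ ⊗ σ v₁`. -/
def tensorReverse (σ : V →ₗ[K] V) : TensorAlgebra K V →ₗ[K] TensorAlgebra K V :=
  (MulOpposite.opLinearEquiv K).symm.toLinearMap ∘ₗ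
    (TensorAlgebra.lift K
      ((MulOpposite.opLinearEquiv K).toLinearMap ∘ₗ TensorAlgebra.ι K ∘ₗ σ)).toLinearMap

theorem tensorReverse_ι (σ : V →ₗ[K] V) (v : V) :
    tensorReverse σ (TensorAlgebra.ι K v) = TensorAlgebra.ι K (σ v) := by
  simp [tensorReverse]

theorem tensorReverse_mul (σ : V →ₗ[K] V) (x y : TensorAlgebra K V) :
    tensorReverse σ (x * y) = tensorReverse σ y * tensorReverse σ x := by
  simp [tensorReverse]

theorem tensorReverse_mem (σ : V →ₗ[K] V) (x : TensorAlgebra K V) (hx : x ∈ tensorPos K V) :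
    tensorReverse σ x ∈ tensorPos K V := by
  rw [mem_tensorPos] at hx
  have key : (⨆ n : ℕ, LinearMap.range (TensorAlgebra.ι K (M := V)) ^ (n + 1)) ≤
      (tensorPos K V).toSubmodule.comap (tensorReverse σ) := by
    refine iSup_le fun n => ?_
    induction n with
    | zero =>
      rw [zero_add, pow_one]
      rintro _ ⟨v, rfl⟩
      rw [Submodule.mem_comap, tensorReverse_ι]
      exact ι_mem_tensorPos _
    | succ n ih =>
      rw [pow_succ, Submodule.mul_le]
      rintro y hy _ ⟨v, rfl⟩
      rw [Submodule.mem_comap, tensorReverse_mul, tensorReverse_ι]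
      exact (tensorPos K V).mul_mem (ι_mem_tensorPos _) (ih hy)
  exact key hx

/-- The involution on `T(V)` induced by an involution `σ` of `V`, with
`(v₁ ⊗ ⋯ ⊗ vₙ)* = vₙ* ⊗ ⋯ ⊗ v₁*`. -/
def tensorStar (σ : V →ₗ[K] V) : tensorPos K V →ₗ[K] tensorPos K V :=
  (tensorReverse σ).restrict (p := (tensorPos K V).toSubmodule)
    (q := (tensorPos K V).toSubmodule) (tensorReverse_mem σ)

end Tensor

end RotaBaxter

end

noncomputable section

namespace RotaBaxter

namespace RBWordAlgebra

section Words

variable {K : Type*} [Field K] {B : Type*} [NonUnitalRing B] [Module K B] {X : Type*}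
  (b : Module.Basis X K B)

/-! The universal property is the composite of two free constructions: `T(V)` is the free nonunitary
algebra on `V`, and the Rota-Baxter words on any basis of an algebra `B` form the free Rota-Baxter
algebra on `B`. The basis `b` serves only to define the words. The rules for the product are first
freed from it, as identities for the linear maps `incl` and `operator` (`incl_mul_assoc`,
`operator_mul_assoc`, `operator_mul_operator`, `operator_operator_mul`, `incl_mul`,
`incl_incl_mul`), each checked on words and extended linearly.

With these identities, associativity (`word_mul_assoc`) and multiplicativity of the extension of a
map from `B` (`lift_word_mul_word`) follow by recursion on the total size of the words. The
essential case is a product of brackets, where the Rota-Baxter identity reduces the claim to smaller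
words.

The involution needs no separate combinatorics: it is the extension `lift` of a map into the
opposite algebra (`op_star`). Hence it reverses products by `lift_mul`, and its remaining properties
follow since multiplicative maps commuting with the operators are determined on `B`. -/

/-- A Rota-Baxter word as an element of the word algebra. -/
def word {h : Bool} (w : RBWord X h) : RBWordAlgebra b := wordBasis b ⟨h, w⟩

/-- The span of the words with head `h`. -/
def headSpan (h : Bool) : Submodule K (RBWordAlgebra b) :=
  Submodule.span K (Set.range fun w : RBWord X h => word b w)

variable {b}

/-! ### Basis-free rules for the product of words -/

theorem word_mem_headSpan {h : Bool} (w : RBWord X h) : word b w ∈ headSpan b h :=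
  Submodule.subset_span ⟨w, rfl⟩

theorem word_mul_word {h h' : Bool} (x : RBWord X h) (y : RBWord X h') :
    word b x * word b y = Finsupp.linearCombination K (word b) (mulWord b x y) := by
  simp only [word, mul_def, mulLin, Module.Basis.constr_basis]
  rfl

theorem linearMap_ext {A : Type*} [AddCommGroup A] [Module K A] {F G : RBWordAlgebra b →ₗ[K] A}
    (hFG : ∀ {h : Bool} (w : RBWord X h), F (word b w) = G (word b w)) : F = G :=
  (wordBasis b).ext fun w => hFG w.2

theorem eqOn_headSpan {A : Type*} [AddCommGroup A] [Module K A] {h : Bool}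
    {F G : RBWordAlgebra b →ₗ[K] A} (hFG : ∀ w : RBWord X h, F (word b w) = G (word b w))
    {t : RBWordAlgebra b} (ht : t ∈ headSpan b h) : F t = G t :=
  LinearMap.eqOn_span (by rintro _ ⟨w, rfl⟩; exact hFG w) ht

theorem word_mul_mem_headSpan {h : Bool} (x : RBWord X h) (m : RBWordAlgebra b) :
    word b x * m ∈ headSpan b h := by
  have hm : m ∈ Submodule.span K (Set.range (wordBasis b)) := by simp [(wordBasis b).span_eq]
  induction hm using Submodule.span_induction with
  | mem y hy =>
    obtain ⟨y, rfl⟩ := hy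
    change word b x * word b y.2 ∈ _
    rw [word_mul_word, headSpan, ← Finsupp.range_linearCombination]
    exact LinearMap.mem_range_self _ _
  | zero => simp
  | add y z _ _ hy hz => rw [mul_add]; exact add_mem hy hz
  | smul c y _ hy => rw [mul_smul_comm]; exact Submodule.smul_mem _ c hy

/-- The product keeps the head of its left factor, so the head conditions in the rules below survive
multiplication on the right and the rules can be iterated. -/
theorem mul_mem_headSpan {h : Bool} {t : RBWordAlgebra b} (ht : t ∈ headSpan b h)
    (m : RBWordAlgebra b) : t * m ∈ headSpan b h := by
  induction ht using Submodule.span_induction with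
  | mem y hy => obtain ⟨y, rfl⟩ := hy; exact word_mul_mem_headSpan y m
  | zero => simp
  | add y z _ _ hy hz => rw [add_mul]; exact add_mem hy hz
  | smul c y _ hy => rw [smul_mul_assoc]; exact Submodule.smul_mem _ c hy

theorem word_letter (x : X) : word b (.letter x) = incl b (b x) := by
  simp [incl, word]

theorem word_bracket {h : Bool} (u : RBWord X h) :
    word b (.bracket u) = operator b (word b u) := by
  simp [operator, word]

/-- Concatenation becomes a product, so that words can be handled as iterated products of values of
`incl` and `operator`. -/
theorem word_letterCons (x : X) (w : RBWord X true) :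
    word b (.letterCons x w) = incl b (b x) * word b w := by
  rw [← word_letter, word_mul_word]
  cases w <;> simp [mulWord]

theorem word_bracketCons {h : Bool} (u : RBWord X h) (w : RBWord X false) :
    word b (.bracketCons u w) = operator b (word b u) * word b w := by
  rw [← word_bracket, word_mul_word]
  cases w <;> simp [mulWord]

/-- A letter in front of a bracket is merely concatenated, and `mulWord` leaves it in place while it
multiplies the tail. Linearity then extends this from words to all three arguments. -/
theorem incl_mul_assoc (a : B) {t : RBWordAlgebra b} (ht : t ∈ headSpan b true)
    (m : RBWordAlgebra b) : incl b a * t * m = incl b a * (t * m) := by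
  have key (x : X) (w : RBWord X true) {h : Bool} (y : RBWord X h) :
      incl b (b x) * word b w * word b y = incl b (b x) * (word b w * word b y) := by
    rw [← word_letterCons, word_mul_word, word_mul_word, mulWord,
      Finsupp.linearCombination_mapDomain, mul_def, Finsupp.apply_linearCombination]
    congr 2
    funext t
    exact word_letterCons x t
  have h1 (x : X) (w : RBWord X true) (m : RBWordAlgebra b) :
      incl b (b x) * word b w * m = incl b (b x) * (word b w * m) :=
    LinearMap.congr_fun (linearMap_ext (F := mulLin b (incl b (b x) * word b w))
      (G := mulLin b (incl b (b x)) ∘ₗ mulLin b (word b w)) fun y => key x w y) m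
  have h2 (x : X) : incl b (b x) * t * m = incl b (b x) * (t * m) :=
    eqOn_headSpan (F := (mulLin b).flip m ∘ₗ mulLin b (incl b (b x)))
      (G := mulLin b (incl b (b x)) ∘ₗ (mulLin b).flip m) (fun w => h1 x w m) ht
  exact LinearMap.congr_fun (b.ext (f₁ := (mulLin b).flip m ∘ₗ (mulLin b).flip t ∘ₗ incl b)
    (f₂ := (mulLin b).flip (t * m) ∘ₗ incl b) h2) a

theorem operator_mul_assoc (a : RBWordAlgebra b) {t : RBWordAlgebra b}
    (ht : t ∈ headSpan b false) (m : RBWordAlgebra b) :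
    operator b a * t * m = operator b a * (t * m) := by
  have key {h' : Bool} (u : RBWord X h') (w : RBWord X false) {h : Bool} (y : RBWord X h) :
      operator b (word b u) * word b w * word b y =
        operator b (word b u) * (word b w * word b y) := by
    rw [← word_bracketCons, word_mul_word, word_mul_word, mulWord,
      Finsupp.linearCombination_mapDomain, mul_def, Finsupp.apply_linearCombination]
    congr 2
    funext t
    exact word_bracketCons u t
  have h1 {h' : Bool} (u : RBWord X h') (w : RBWord X false) (m : RBWordAlgebra b) :
      operator b (word b u) * word b w * m = operator b (word b u) * (word b w * m) :=
    LinearMap.congr_fun (linearMap_ext (F := mulLin b (operator b (word b u) * word b w))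
      (G := mulLin b (operator b (word b u)) ∘ₗ mulLin b (word b w)) fun y => key u w y) m
  have h2 {h' : Bool} (u : RBWord X h') :
      operator b (word b u) * t * m = operator b (word b u) * (t * m) :=
    eqOn_headSpan (F := (mulLin b).flip m ∘ₗ mulLin b (operator b (word b u)))
      (G := mulLin b (operator b (word b u)) ∘ₗ (mulLin b).flip m) (fun w => h1 u w m) ht
  exact LinearMap.congr_fun (linearMap_ext
    (F := (mulLin b).flip m ∘ₗ (mulLin b).flip t ∘ₗ operator b)
    (G := (mulLin b).flip (t * m) ∘ₗ operator b) fun u => h2 u) a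

theorem operator_mul_operator (a c : RBWordAlgebra b) :
    operator b a * operator b c = operator b (a * operator b c + operator b a * c) := by
  have key {h h' : Bool} (u : RBWord X h) (v : RBWord X h') :
      operator b (word b u) * operator b (word b v) =
        operator b (word b u * operator b (word b v) + operator b (word b u) * word b v) := by
    simp only [← word_bracket, word_mul_word, mulWord, map_add,
      Finsupp.linearCombination_mapDomain, Finsupp.apply_linearCombination]
    -- `mulWord` lists the two summands in the opposite order.
    rw [add_comm]
    congr 3 <;> funext t <;> exact word_bracket t
  have h1 {h : Bool} (u : RBWord X h) :
      operator b (word b u) * operator b c =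
        operator b (word b u * operator b c + operator b (word b u) * c) :=
    LinearMap.congr_fun (linearMap_ext
      (F := mulLin b (operator b (word b u)) ∘ₗ operator b)
      (G := operator b ∘ₗ (mulLin b (word b u) ∘ₗ operator b + mulLin b (operator b (word b u))))
      fun v => key u v) c
  exact LinearMap.congr_fun (linearMap_ext
      (F := (mulLin b).flip (operator b c) ∘ₗ operator b)
      (G := operator b ∘ₗ ((mulLin b).flip (operator b c) + (mulLin b).flip c ∘ₗ operator b))
      fun u => h1 u) a

/-- Multiplying by a bracket affects only the first component `⌊v⌋` of `⌊v⌋ w`; the tail `w` is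
appended unchanged to both summands of `⌊u⌋ ⌊v⌋`. -/
theorem operator_operator_mul (a c : RBWordAlgebra b) {t : RBWordAlgebra b}
    (ht : t ∈ headSpan b false) :
    operator b a * (operator b c * t) = operator b a * operator b c * t := by
  have key {h h' : Bool} (u : RBWord X h) (v : RBWord X h') (w : RBWord X false) :
      operator b (word b u) * (operator b (word b v) * word b w) =
        operator b (word b u) * operator b (word b v) * word b w := by
    have hlc (l : RBWord X true →₀ K) : Finsupp.linearCombination K (word b) l * word b w =
        Finsupp.linearCombination K (fun z => word b z * word b w) l :=
      Finsupp.apply_linearCombination K ((mulLin b).flip (word b w)) _ _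
    rw [← word_bracketCons, ← word_bracket, ← word_bracket, word_mul_word, word_mul_word, hlc]
    simp only [mulWord, map_add, Finsupp.linearCombination_mapDomain]
    congr 3 <;> funext t <;> simp [word_bracket, word_bracketCons]
  have h1 {h h' : Bool} (u : RBWord X h) (v : RBWord X h') :
      operator b (word b u) * (operator b (word b v) * t) =
        operator b (word b u) * operator b (word b v) * t :=
    eqOn_headSpan
      (F := mulLin b (operator b (word b u)) ∘ₗ mulLin b (operator b (word b v)))
      (G := mulLin b (operator b (word b u) * operator b (word b v))) (fun w => key u v w) ht
  have h2 {h : Bool} (u : RBWord X h) :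
      operator b (word b u) * (operator b c * t) = operator b (word b u) * operator b c * t :=
    LinearMap.congr_fun (linearMap_ext
      (F := mulLin b (operator b (word b u)) ∘ₗ (mulLin b).flip t ∘ₗ operator b)
      (G := (mulLin b).flip t ∘ₗ mulLin b (operator b (word b u)) ∘ₗ operator b)
      fun v => h1 u v) c
  exact LinearMap.congr_fun (linearMap_ext
      (F := (mulLin b).flip (operator b c * t) ∘ₗ operator b)
      (G := (mulLin b).flip t ∘ₗ (mulLin b).flip (operator b c) ∘ₗ operator b)
      fun u => h2 u) a

/-! ### Extension of linear maps from `B` to words -/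

section Lift

variable {A : Type*} [NonUnitalNonAssocRing A] [Module K A]

variable (b) in
/-- The extension to words of a map `g` on `B`, with brackets sent to values of `R`. -/
def liftWord (g : B →ₗ[K] A) (R : A →ₗ[K] A) : {h : Bool} → RBWord X h → A
  | _, .letter x => g (b x)
  | _, .bracket u => R (liftWord g R u)
  | _, .letterCons x w => g (b x) * liftWord g R w
  | _, .bracketCons u w => R (liftWord g R u) * liftWord g R w

variable (b) in
/-- The linear extension of `liftWord`. -/
def lift (g : B →ₗ[K] A) (R : A →ₗ[K] A) : RBWordAlgebra b →ₗ[K] A :=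
  (wordBasis b).constr K fun x => liftWord b g R x.2

variable {g : B →ₗ[K] A} {R : A →ₗ[K] A}

theorem lift_word {h : Bool} (w : RBWord X h) : lift b g R (word b w) = liftWord b g R w := by
  simp [lift, word]

theorem lift_incl (a : B) : lift b g R (incl b a) = g a := by
  refine LinearMap.congr_fun (b.ext (f₁ := lift b g R ∘ₗ incl b) fun x => ?_) a
  rw [LinearMap.comp_apply, ← word_letter, lift_word, liftWord]

theorem lift_operator (m : RBWordAlgebra b) :
    lift b g R (operator b m) = R (lift b g R m) := by
  refine LinearMap.congr_fun
    (linearMap_ext (F := lift b g R ∘ₗ operator b) (G := R ∘ₗ lift b g R) fun w => ?_) m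
  rw [LinearMap.comp_apply, LinearMap.comp_apply, ← word_bracket, lift_word, lift_word, liftWord]

variable [IsScalarTower K A A] [SMulCommClass K A A]

theorem lift_incl_mul (a : B) {t : RBWordAlgebra b} (ht : t ∈ headSpan b true) :
    lift b g R (incl b a * t) = g a * lift b g R t := by
  have h1 (x : X) : lift b g R (incl b (b x) * t) = g (b x) * lift b g R t := by
    refine eqOn_headSpan (F := lift b g R ∘ₗ mulLin b (incl b (b x)))
      (G := LinearMap.mulLeft K (g (b x)) ∘ₗ lift b g R) (fun w => ?_) ht
    change lift b g R (incl b (b x) * word b w) = g (b x) * lift b g R (word b w)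
    rw [← word_letterCons, lift_word, lift_word, liftWord]
  exact LinearMap.congr_fun (b.ext (f₁ := lift b g R ∘ₗ (mulLin b).flip t ∘ₗ incl b)
    (f₂ := LinearMap.mulRight K (lift b g R t) ∘ₗ g) h1) a

theorem lift_operator_mul (m : RBWordAlgebra b) {t : RBWordAlgebra b}
    (ht : t ∈ headSpan b false) :
    lift b g R (operator b m * t) = R (lift b g R m) * lift b g R t := by
  have h1 {h : Bool} (u : RBWord X h) :
      lift b g R (operator b (word b u) * t) = R (lift b g R (word b u)) * lift b g R t := by
    refine eqOn_headSpan (F := lift b g R ∘ₗ mulLin b (operator b (word b u)))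
      (G := LinearMap.mulLeft K (R (lift b g R (word b u))) ∘ₗ lift b g R) (fun w => ?_) ht
    change lift b g R (operator b (word b u) * word b w) =
      R (lift b g R (word b u)) * lift b g R (word b w)
    rw [← word_bracketCons, lift_word, lift_word, lift_word, liftWord]
  exact LinearMap.congr_fun (linearMap_ext
    (F := lift b g R ∘ₗ (mulLin b).flip t ∘ₗ operator b)
    (G := LinearMap.mulRight K (lift b g R t) ∘ₗ R ∘ₗ lift b g R) fun u => h1 u) m

end Lift

/-- A multiplicative linear map that intertwines the operators is determined on `B`. -/
theorem eq_of_comp_incl_eq {A : Type*} [NonUnitalNonAssocRing A] [Module K A] {R : A →ₗ[K] A}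
    {F G : RBWordAlgebra b →ₗ[K] A} (hF : ∀ m n, F (m * n) = F m * F n)
    (hG : ∀ m n, G (m * n) = G m * G n) (hFR : ∀ m, F (operator b m) = R (F m))
    (hGR : ∀ m, G (operator b m) = R (G m)) (h : ∀ a, F (incl b a) = G (incl b a)) : F = G := by
  refine linearMap_ext fun w => ?_
  induction w with
  | letter x => simp only [word_letter, h]
  | bracket u ih => simp only [word_bracket, hFR, hGR, ih]
  | letterCons x w ih => simp only [word_letterCons, hF, hG, h, ih]
  | bracketCons u w ihu ihw => simp only [word_bracketCons, hF, hG, hFR, hGR, ihu, ihw]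

/-! ### The involution on generators -/

open MulOpposite in
-- An antihomomorphism is a homomorphism into the opposite algebra. Read there, the recursion of
-- `starWord` is that of `liftWord`, so the results on `lift` apply to `star`.
theorem op_star (σ : B →ₗ[K] B) (m : RBWordAlgebra b) :
    op (star b σ m) =
      lift b ((opLinearEquiv K).toLinearMap ∘ₗ incl b ∘ₗ σ)
        ((opLinearEquiv K).toLinearMap ∘ₗ operator b ∘ₗ (opLinearEquiv K).symm.toLinearMap) m := by
  refine LinearMap.congr_fun (linearMap_ext
    (F := (opLinearEquiv K).toLinearMap ∘ₗ star b σ) fun w => ?_) m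
  rw [lift_word, LinearMap.comp_apply]
  have hw : star b σ (word b w) = starWord b σ w := by simp [star, word]
  rw [hw]
  induction w with
  | letter x => simp [starWord, liftWord]
  | bracket u ih =>
    rw [liftWord, ← ih (by simp [star, word])]
    simp [starWord]
  | letterCons x w ih =>
    rw [liftWord, ← ih (by simp [star, word])]
    simp [starWord]
  | bracketCons u w ihu ihw =>
    rw [liftWord, ← ihu (by simp [star, word]), ← ihw (by simp [star, word])]
    simp [starWord]

theorem star_incl (σ : B →ₗ[K] B) (a : B) : star b σ (incl b a) = incl b (σ a) :=
  MulOpposite.op_injective (by rw [op_star, lift_incl]; simp)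

theorem star_operator (σ : B →ₗ[K] B) (m : RBWordAlgebra b) :
    star b σ (operator b m) = operator b (star b σ m) :=
  MulOpposite.op_injective (by rw [op_star, lift_operator, ← op_star]; simp)

/-! ### The product of `B` among the letters -/

variable [IsScalarTower K B B] [SMulCommClass K B B]

theorem incl_mul (a c : B) : incl b (a * c) = incl b a * incl b c := by
  have key (x y : X) : incl b (b x * b y) = incl b (b x) * incl b (b y) := by
    rw [← word_letter, ← word_letter, word_mul_word, mulWord, Finsupp.linearCombination_mapDomain,
      incl, Module.Basis.constr_apply, Finsupp.linearCombination_apply]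
    rfl
  have h1 (x : X) : incl b (b x * c) = incl b (b x) * incl b c :=
    LinearMap.congr_fun (b.ext (f₁ := incl b ∘ₗ LinearMap.mulLeft K (b x))
      (f₂ := mulLin b (incl b (b x)) ∘ₗ incl b) (key x)) c
  exact LinearMap.congr_fun (b.ext (f₁ := incl b ∘ₗ LinearMap.mulRight K c)
    (f₂ := (mulLin b).flip (incl b c) ∘ₗ incl b) h1) a

theorem incl_incl_mul (a c : B) {t : RBWordAlgebra b} (ht : t ∈ headSpan b true) :
    incl b a * (incl b c * t) = incl b (a * c) * t := by
  have key (x y : X) (w : RBWord X true) :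
      incl b (b x) * (incl b (b y) * word b w) = incl b (b x * b y) * word b w := by
    have hlc (l : X →₀ K) : Finsupp.linearCombination K (fun z => incl b (b z)) l * word b w =
        Finsupp.linearCombination K (fun z => incl b (b z) * word b w) l :=
      Finsupp.apply_linearCombination K ((mulLin b).flip (word b w)) _ _
    have hincl : incl b (b x * b y) =
        Finsupp.linearCombination K (fun z => incl b (b z)) (b.repr (b x * b y)) := by
      conv_lhs => rw [← b.linearCombination_repr (b x * b y), Finsupp.apply_linearCombination]
      rfl
    rw [← word_letterCons, ← word_letter, word_mul_word, hincl, hlc, mulWord,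
      Finsupp.linearCombination_mapDomain]
    congr 2
    funext z
    exact word_letterCons z w
  have h1 (x y : X) : incl b (b x) * (incl b (b y) * t) = incl b (b x * b y) * t :=
    eqOn_headSpan (F := mulLin b (incl b (b x)) ∘ₗ mulLin b (incl b (b y)))
      (G := mulLin b (incl b (b x * b y))) (fun w => key x y w) ht
  have h2 (x : X) : incl b (b x) * (incl b c * t) = incl b (b x * c) * t :=
    LinearMap.congr_fun (b.ext
      (f₁ := mulLin b (incl b (b x)) ∘ₗ (mulLin b).flip t ∘ₗ incl b)
      (f₂ := (mulLin b).flip t ∘ₗ incl b ∘ₗ LinearMap.mulLeft K (b x)) (h1 x)) c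
  exact LinearMap.congr_fun (b.ext
      (f₁ := (mulLin b).flip (incl b c * t) ∘ₗ incl b)
      (f₂ := (mulLin b).flip t ∘ₗ incl b ∘ₗ LinearMap.mulRight K c) h2) a

/-! ### Associativity -/

/-- A tail of the left or middle factor is split off by the rules above. A one-component left factor
next to a component of the other kind is only concatenated. What remains is letters against letters,
settled in `B`, and brackets against brackets. -/
theorem word_mul_assoc : {h h' h'' : Bool} → (x : RBWord X h) → (y : RBWord X h') →
    (z : RBWord X h'') → word b x * word b y * word b z = word b x * (word b y * word b z)
  | _, _, _, .letterCons x w, y, z => by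
    have hw := word_mem_headSpan (b := b) w
    rw [word_letterCons, incl_mul_assoc _ hw, incl_mul_assoc _ (mul_mem_headSpan hw _),
      incl_mul_assoc _ hw, word_mul_assoc w y z]
  | _, _, _, .bracketCons u w, y, z => by
    have hw := word_mem_headSpan (b := b) w
    rw [word_bracketCons, operator_mul_assoc _ hw, operator_mul_assoc _ (mul_mem_headSpan hw _),
      operator_mul_assoc _ hw, word_mul_assoc w y z]
  | _, true, _, .letter x, y, z => by
    rw [word_letter, incl_mul_assoc _ (word_mem_headSpan y)]
  | _, _, _, .letter x, .letterCons y w, z => by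
    have hw := word_mem_headSpan (b := b) w
    rw [word_letter, word_letterCons, incl_incl_mul _ _ hw, incl_mul_assoc _ hw,
      incl_mul_assoc _ hw, incl_incl_mul _ _ (mul_mem_headSpan hw _)]
  | _, _, true, .letter x, .letter y, z => by
    rw [word_letter, word_letter, incl_incl_mul _ _ (word_mem_headSpan z), incl_mul]
  | _, _, _, .letter x, .letter y, .letter z => by
    simp only [word_letter, ← incl_mul, mul_assoc]
  | _, _, _, .letter x, .letter y, .letterCons z w => by
    have hw := word_mem_headSpan (b := b) w
    simp only [word_letter, word_letterCons, ← incl_mul, incl_incl_mul _ _ hw, mul_assoc]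
  | _, false, _, .bracket u, y, z => by
    rw [word_bracket, operator_mul_assoc _ (word_mem_headSpan y)]
  | _, _, _, .bracket u, .bracketCons v w, z => by
    have hw := word_mem_headSpan (b := b) w
    rw [word_bracket, word_bracketCons, operator_operator_mul _ _ hw, operator_mul_operator,
      operator_mul_assoc _ hw, operator_mul_assoc _ hw,
      operator_operator_mul _ _ (mul_mem_headSpan hw _), operator_mul_operator]
  | _, _, false, .bracket u, .bracket v, z => by
    rw [word_bracket, word_bracket, operator_operator_mul _ _ (word_mem_headSpan z)]
  -- Two uses of the Rota-Baxter identity turn each side into the bracket of three triple products,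
  -- which agree pairwise by `h1`, `h2` and `h3`.
  | _, _, _, .bracket u, .bracket v, .bracket w => by
    have h1 := word_mul_assoc u (.bracket v) (.bracket w)
    have h2 := word_mul_assoc (.bracket u) v (.bracket w)
    have h3 := word_mul_assoc (.bracket u) (.bracket v) w
    simp only [word_bracket] at h1 h2 h3 ⊢
    rw [operator_mul_operator (word b u) (word b v), operator_mul_operator,
      ← operator_mul_operator (word b u) (word b v), add_mul, h1, h2, h3,
      operator_mul_operator (word b v) (word b w), operator_mul_operator (word b u),
      ← operator_mul_operator (word b v) (word b w), mul_add, add_assoc]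
  | _, _, _, .bracket u, .bracket v, .bracketCons w t => by
    have ht := word_mem_headSpan (b := b) t
    have h1 := word_mul_assoc (.bracket u) (.bracket v) (.bracket w)
    simp only [word_bracket, word_bracketCons] at h1 ⊢
    rw [operator_operator_mul _ _ ht, operator_mul_operator (word b u) (word b v),
      operator_operator_mul _ _ ht, ← operator_mul_operator (word b u) (word b v), h1,
      operator_mul_operator (word b v) (word b w), operator_operator_mul _ _ ht]
  termination_by _ _ _ x y z => sizeOf x + sizeOf y + sizeOf z
  decreasing_by
    all_goals simp only [RBWord.letterCons.sizeOf_spec, RBWord.bracketCons.sizeOf_spec,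
      RBWord.bracket.sizeOf_spec]
    -- Passing from `⌊w⌋ t` to `⌊w⌋` lowers the size because `t` has positive size.
    all_goals have hpos {h : Bool} (w : RBWord X h) : 0 < sizeOf w := by cases w <;> simp +arith
    all_goals grind

variable (b) in
protected theorem mul_assoc (l m n : RBWordAlgebra b) : l * m * n = l * (m * n) := by
  have h1 {h h' : Bool} (x : RBWord X h) (y : RBWord X h') :
      word b x * word b y * n = word b x * (word b y * n) :=
    LinearMap.congr_fun (linearMap_ext (F := mulLin b (word b x * word b y))
      (G := mulLin b (word b x) ∘ₗ mulLin b (word b y)) fun z => word_mul_assoc x y z) n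
  have h2 {h : Bool} (x : RBWord X h) : word b x * m * n = word b x * (m * n) :=
    LinearMap.congr_fun (linearMap_ext (F := (mulLin b).flip n ∘ₗ mulLin b (word b x))
      (G := mulLin b (word b x) ∘ₗ (mulLin b).flip n) fun y => h1 x y) m
  exact LinearMap.congr_fun (linearMap_ext (F := (mulLin b).flip n ∘ₗ (mulLin b).flip m)
      (G := (mulLin b).flip (m * n)) fun x => h2 x) l

/-! ### Multiplicativity of the extension -/

section Lift

variable {A : Type*} [NonUnitalNonAssocRing A] [Module K A] [IsScalarTower K A A]
  [SMulCommClass K A A] {g : B →ₗ[K] A} {R : A →ₗ[K] A}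

/-- The case analysis follows the recursion of `mulWord`. Associativity of `A` is a hypothesis and
not an instance, so that the opposite of the word algebra can serve as the target. -/
theorem lift_word_mul_word (hA : ∀ x y z : A, x * y * z = x * (y * z))
    (hg : ∀ a c, g (a * c) = g a * g c)
    (hR : ∀ x y, R x * R y = R (x * R y + R x * y)) :
    {h h' : Bool} → (x : RBWord X h) → (y : RBWord X h') →
    lift b g R (word b x * word b y) = lift b g R (word b x) * lift b g R (word b y)
  | _, _, .letterCons x w, y => by
    have hw := word_mem_headSpan (b := b) w
    rw [word_letterCons, incl_mul_assoc _ hw, lift_incl_mul _ (mul_mem_headSpan hw _),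
      lift_incl_mul _ hw, lift_word_mul_word hA hg hR w y, hA]
  | _, _, .bracketCons u w, y => by
    have hw := word_mem_headSpan (b := b) w
    rw [word_bracketCons, operator_mul_assoc _ hw, lift_operator_mul _ (mul_mem_headSpan hw _),
      lift_operator_mul _ hw, lift_word_mul_word hA hg hR w y, hA]
  | _, true, .letter x, y => by
    rw [word_letter, lift_incl_mul _ (word_mem_headSpan y), lift_incl]
  | _, _, .letter x, .letter y => by
    rw [word_letter, word_letter, ← incl_mul, lift_incl, lift_incl, lift_incl, hg]
  | _, _, .letter x, .letterCons y w => by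
    have hw := word_mem_headSpan (b := b) w
    rw [word_letter, word_letterCons, incl_incl_mul _ _ hw, lift_incl_mul _ hw,
      lift_incl_mul _ hw, lift_incl, hg, hA]
  | _, false, .bracket u, y => by
    rw [word_bracket, lift_operator_mul _ (word_mem_headSpan y), lift_operator]
  | _, _, .bracket u, .bracket v => by
    have h1 := lift_word_mul_word hA hg hR u (.bracket v)
    have h2 := lift_word_mul_word hA hg hR (.bracket u) v
    simp only [word_bracket, lift_operator] at h1 h2 ⊢
    rw [operator_mul_operator, lift_operator, map_add, h1, h2, hR]
  | _, _, .bracket u, .bracketCons v w => by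
    have hw := word_mem_headSpan (b := b) w
    have h1 := lift_word_mul_word hA hg hR u (.bracket v)
    have h2 := lift_word_mul_word hA hg hR (.bracket u) v
    simp only [word_bracket, word_bracketCons, lift_operator] at h1 h2 ⊢
    rw [operator_operator_mul _ _ hw, operator_mul_operator, lift_operator_mul _ hw, map_add, h1,
      h2, ← hR, lift_operator_mul _ hw, hA]
  termination_by _ _ x y => sizeOf x + sizeOf y

theorem lift_mul (hA : ∀ x y z : A, x * y * z = x * (y * z))
    (hg : ∀ a c, g (a * c) = g a * g c)
    (hR : ∀ x y, R x * R y = R (x * R y + R x * y)) (m n : RBWordAlgebra b) :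
    lift b g R (m * n) = lift b g R m * lift b g R n := by
  have h1 {h : Bool} (x : RBWord X h) :
      lift b g R (word b x * n) = lift b g R (word b x) * lift b g R n :=
    LinearMap.congr_fun (linearMap_ext (F := lift b g R ∘ₗ mulLin b (word b x))
      (G := LinearMap.mulLeft K (lift b g R (word b x)) ∘ₗ lift b g R)
      fun y => lift_word_mul_word hA hg hR x y) n
  exact LinearMap.congr_fun (linearMap_ext (F := lift b g R ∘ₗ (mulLin b).flip n)
      (G := LinearMap.mulRight K (lift b g R n) ∘ₗ lift b g R) fun x => h1 x) m

end Lift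

/-! ### The involution -/

theorem star_mul {σ : B →ₗ[K] B} (hσ : ∀ x y, σ (x * y) = σ y * σ x) (m n : RBWordAlgebra b) :
    star b σ (m * n) = star b σ n * star b σ m := by
  refine MulOpposite.op_injective ?_
  rw [MulOpposite.op_mul, op_star, op_star, op_star]
  refine lift_mul (fun x y z => ?_) (fun x y => ?_) (fun x y => ?_) m n
  · exact MulOpposite.unop_injective (RBWordAlgebra.mul_assoc b _ _ _).symm
  · simp [hσ, incl_mul]
  · refine MulOpposite.unop_injective ?_
    -- The Rota-Baxter identity is symmetric: reversing the product only swaps its two summands.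
    simpa [add_comm] using operator_mul_operator y.unop x.unop

theorem star_star {σ : B →ₗ[K] B} (hσ : ∀ x y, σ (x * y) = σ y * σ x) (hσσ : ∀ x, σ (σ x) = x)
    (m : RBWordAlgebra b) : star b σ (star b σ m) = m := by
  refine LinearMap.congr_fun (eq_of_comp_incl_eq (R := operator b)
    (F := star b σ ∘ₗ star b σ) (G := LinearMap.id) ?_ ?_ ?_ ?_ ?_) m <;>
  simp [star_mul hσ, star_operator, star_incl, hσσ]

theorem isInvolutiveRotaBaxter {σ : B →ₗ[K] B} (hσ : ∀ x y, σ (x * y) = σ y * σ x)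
    (hσσ : ∀ x, σ (σ x) = x) : IsInvolutiveRotaBaxter (star b σ) (operator b) where
  mul_assoc := RBWordAlgebra.mul_assoc b
  star_star := star_star hσ hσσ
  star_mul := star_mul hσ
  rota_baxter := operator_mul_operator
  map_star m := (star_operator σ m).symm

/-- An algebra map that intertwines the operators and preserves the involutions on `B` preserves
the involutions. -/
theorem map_star_of_comp_incl {σ : B →ₗ[K] B} (hσ : ∀ x y, σ (x * y) = σ y * σ x)
    {A : Type*} [NonUnitalNonAssocRing A] [Module K A] [IsScalarTower K A A] [SMulCommClass K A A]
    {starA R : A →ₗ[K] A} (hA : IsInvolutiveRotaBaxter starA R) {F : RBWordAlgebra b →ₗ[K] A}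
    (hF : ∀ m n, F (m * n) = F m * F n) (hFR : ∀ m, F (operator b m) = R (F m))
    (h : ∀ a, F (incl b (σ a)) = starA (F (incl b a))) (m : RBWordAlgebra b) :
    F (star b σ m) = starA (F m) := by
  -- `F ∘ star` and `starA ∘ F` both reverse products, so in the opposite algebra they are
  -- multiplicative and can be compared on `B`.
  let e := MulOpposite.opLinearEquiv (M := A) K
  refine e.injective (LinearMap.congr_fun (eq_of_comp_incl_eq
    (R := e.toLinearMap ∘ₗ R ∘ₗ e.symm.toLinearMap)
    (F := e.toLinearMap ∘ₗ F ∘ₗ star b σ) (G := e.toLinearMap ∘ₗ starA ∘ₗ F) ?_ ?_ ?_ ?_ ?_) m) <;>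
  simp [e, star_mul hσ, star_operator, star_incl, hF, hFR, hA.star_mul, hA.map_star, h]

end Words

end RBWordAlgebra

/-! ### The nonunitary tensor algebra -/

section Tensor

variable {K : Type*} [Field K] {V : Type*} [AddCommGroup V] [Module K V]

theorem tensorStar_incl (σ : V →ₗ[K] V) (v : V) :
    tensorStar σ (tensorIncl K v) = tensorIncl K (σ v) :=
  Subtype.ext (tensorReverse_ι σ v)

theorem tensorStar_mul (σ : V →ₗ[K] V) (x y : tensorPos K V) :
    tensorStar σ (x * y) = tensorStar σ y * tensorStar σ x :=
  Subtype.ext (tensorReverse_mul σ x y)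

/-- A multiplicative linear map on the nonunitary tensor algebra is determined on `V`. -/
theorem eq_of_comp_tensorIncl_eq {A : Type*} [NonUnitalNonAssocRing A] [Module K A]
    {F G : tensorPos K V →ₗ[K] A} (hF : ∀ x y, F (x * y) = F x * F y)
    (hG : ∀ x y, G (x * y) = G x * G y) (h : ∀ v, F (tensorIncl K v) = G (tensorIncl K v)) :
    F = G := by
  -- The locus where `F` and `G` agree, viewed in the tensor algebra, contains `V` and is stable
  -- under right multiplication by `V`.
  have key : (⨆ n : ℕ, LinearMap.range (TensorAlgebra.ι K (M := V)) ^ (n + 1)) ≤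
      (LinearMap.eqLocus F G).map (tensorPos K V).toSubmodule.subtype := by
    refine iSup_le fun n => ?_
    induction n with
    | zero =>
      rw [zero_add, pow_one]
      rintro _ ⟨v, rfl⟩
      exact ⟨tensorIncl K v, h v, rfl⟩
    | succ n ih =>
      rw [pow_succ, Submodule.mul_le]
      rintro y hy _ ⟨v, rfl⟩
      obtain ⟨y, hFG, rfl⟩ := ih hy
      let y : tensorPos K V := y
      have hFG : F y = G y := hFG
      refine ⟨y * tensorIncl K v, ?_, rfl⟩
      change F (y * tensorIncl K v) = G (y * tensorIncl K v)
      rw [hF, hG, h, hFG]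
  ext x
  obtain ⟨y, hy, hyx⟩ := key x.2
  obtain rfl : y = x := Subtype.ext hyx
  exact hy

theorem tensorStar_tensorStar {σ : V →ₗ[K] V} (hσ : ∀ v, σ (σ v) = v) (x : tensorPos K V) :
    tensorStar σ (tensorStar σ x) = x := by
  refine LinearMap.congr_fun (eq_of_comp_tensorIncl_eq (F := tensorStar σ ∘ₗ tensorStar σ)
    (G := LinearMap.id) ?_ ?_ ?_) x <;>
  simp [tensorStar_mul, tensorStar_incl, hσ]

/-- `A` may lack a unit, so `f` is extended to a unital algebra map into the unitization of `A`.
Tensors of positive degree have zero scalar part there, which makes the `A`-component multiplicative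
on them. -/
theorem exists_tensorPos_lift {A : Type*} [NonUnitalRing A] [Module K A] [IsScalarTower K A A]
    [SMulCommClass K A A] (f : V →ₗ[K] A) :
    ∃ g : tensorPos K V →ₗ[K] A, (∀ x y, g (x * y) = g x * g y) ∧
      ∀ v, g (tensorIncl K v) = f v := by
  let φ : TensorAlgebra K V →ₐ[K] Unitization K A :=
    TensorAlgebra.lift K (Unitization.inrHom K K A ∘ₗ f)
  have hφ (v : V) : φ (TensorAlgebra.ι K v) = Unitization.inr (f v) := by simp [φ]
  have key : (⨆ n : ℕ, LinearMap.range (TensorAlgebra.ι K (M := V)) ^ (n + 1)) ≤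
      LinearMap.ker ((Unitization.fstHom K A).toLinearMap ∘ₗ φ.toLinearMap) := by
    refine iSup_le fun n => ?_
    rw [pow_succ, Submodule.mul_le]
    rintro y hy _ ⟨v, rfl⟩
    simp [hφ]
  have hfst (x : tensorPos K V) : (φ x).fst = 0 := key x.2
  refine ⟨Unitization.sndHom K K A ∘ₗ φ.toLinearMap ∘ₗ (tensorPos K V).toSubmodule.subtype,
    fun x y => ?_, fun v => ?_⟩
  · change (φ (x * y : TensorAlgebra K V)).snd = (φ x).snd * (φ y).snd
    rw [map_mul, Unitization.snd_mul, hfst, hfst]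
    simp
  · change (φ (TensorAlgebra.ι K v)).snd = f v
    simp [hφ]

end Tensor

end RotaBaxter

end

/-! ### The universal property over `V` -/

theorem mainTheorem8 {K : Type*} [Field K] [CharZero K]
    {V : Type*} [AddCommGroup V] [Module K V]
    (σ : V →ₗ[K] V) (hσ : ∀ v, σ (σ v) = v)
    {X : Type*} (b : Module.Basis X K (RotaBaxter.tensorPos K V)) :
    RotaBaxter.IsInvolutiveRotaBaxter
        (RotaBaxter.RBWordAlgebra.star b (RotaBaxter.tensorStar σ))
        (RotaBaxter.RBWordAlgebra.operator b) ∧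
      (∀ v : V, RotaBaxter.RBWordAlgebra.incl b (RotaBaxter.tensorIncl K (σ v)) =
        RotaBaxter.RBWordAlgebra.star b (RotaBaxter.tensorStar σ)
          (RotaBaxter.RBWordAlgebra.incl b (RotaBaxter.tensorIncl K v))) ∧
      ∀ (A : Type*) [NonUnitalRing A] [Module K A] [IsScalarTower K A A] [SMulCommClass K A A]
        (starA R : A →ₗ[K] A), RotaBaxter.IsInvolutiveRotaBaxter starA R →
        ∀ f : V →ₗ[K] A, (∀ v, f (σ v) = starA (f v)) →
          ∃! F : RotaBaxter.RBWordAlgebra b →ₙₐ[K] A,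
            RotaBaxter.IsInvolutiveRotaBaxterHom
              (RotaBaxter.RBWordAlgebra.star b (RotaBaxter.tensorStar σ))
              (RotaBaxter.RBWordAlgebra.operator b) starA R F ∧
            ∀ v : V, F (RotaBaxter.RBWordAlgebra.incl b (RotaBaxter.tensorIncl K v)) = f v := by
  have hmul := RotaBaxter.tensorStar_mul σ
  refine ⟨RotaBaxter.RBWordAlgebra.isInvolutiveRotaBaxter hmul
    (RotaBaxter.tensorStar_tensorStar hσ), fun v => ?_, ?_⟩
  · rw [RotaBaxter.RBWordAlgebra.star_incl, RotaBaxter.tensorStar_incl]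
  intro A _ _ _ _ starA R hA f hf
  obtain ⟨g, hg, hgf⟩ := RotaBaxter.exists_tensorPos_lift f
  have hgσ (x) : g (RotaBaxter.tensorStar σ x) = starA (g x) := by
    -- Both sides reverse products, so they are compared on `V` as multiplicative maps into the
    -- opposite algebra.
    let e := MulOpposite.opLinearEquiv (M := A) K
    refine e.injective (LinearMap.congr_fun (RotaBaxter.eq_of_comp_tensorIncl_eq
      (F := e.toLinearMap ∘ₗ g ∘ₗ RotaBaxter.tensorStar σ)
      (G := e.toLinearMap ∘ₗ starA ∘ₗ g) ?_ ?_ ?_) x) <;>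
    simp [e, hmul, hg, hA.star_mul, RotaBaxter.tensorStar_incl, hgf, hf]
  have hF := RotaBaxter.RBWordAlgebra.lift_mul (b := b) hA.mul_assoc hg hA.rota_baxter
  refine ⟨{ RotaBaxter.RBWordAlgebra.lift b g R with
      map_zero' := map_zero _
      map_mul' := hF }, ⟨⟨fun m => ?_, fun m => ?_⟩, fun v => ?_⟩, ?_⟩
  · exact RotaBaxter.RBWordAlgebra.map_star_of_comp_incl hmul hA hF
      RotaBaxter.RBWordAlgebra.lift_operator
      (fun a => by simp only [RotaBaxter.RBWordAlgebra.lift_incl, hgσ]) m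
  · exact RotaBaxter.RBWordAlgebra.lift_operator m
  · exact (RotaBaxter.RBWordAlgebra.lift_incl _).trans (hgf v)
  · rintro G ⟨hG, hGf⟩
    -- Uniqueness in two stages: the values on `V` determine `G` on `T(V)`, and those determine it
    -- on all words.
    have hGg : (G : RotaBaxter.RBWordAlgebra b →ₗ[K] A) ∘ₗ RotaBaxter.RBWordAlgebra.incl b = g :=
      RotaBaxter.eq_of_comp_tensorIncl_eq
        (fun x y => by simp [RotaBaxter.RBWordAlgebra.incl_mul]) hg
        (fun v => (hGf v).trans (hgf v).symm)
    have hGF : (G : RotaBaxter.RBWordAlgebra b →ₗ[K] A) = RotaBaxter.RBWordAlgebra.lift b g R :=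
      RotaBaxter.RBWordAlgebra.eq_of_comp_incl_eq (R := R) (fun m n => map_mul G m n) hF
        hG.map_operator RotaBaxter.RBWordAlgebra.lift_operator fun a =>
        (LinearMap.congr_fun hGg a).trans (RotaBaxter.RBWordAlgebra.lift_incl a).symm
    exact NonUnitalAlgHom.ext fun m => LinearMap.congr_fun hGF m
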